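/- **Setting.** Let $f:\mathbb R^n\to\mathbb R$ be locally Lipschitz and let $\partial f$ denote its Clarke subdifferential; $x$ is a *critical point* of $\min_{x\in\mathbb R^n} f(x)$ if $0\in\partial f(x)$. A function $\phi:\mathbb R^n\times\mathbb R^n\to\mathbb R$ is a *strict first-order model* of $f$ if - $(M_1)$ $\phi(\cdot,x)$ is convex, $\phi(x,x)=f(x)$, and $\partial_1\phi(x,x)\subset\partial f(x)$, where $\partial_1$ is the convex subdifferential in the first variable; - $(\widehat M_2)$ if $x_k,y_k\to x$, there are $\epsilon_k\to0^+$ with $f(y_k)\le\phi(y_k,x_k)+\epsilon_k\|y_k-x_k\|$; - $(M_3)$ if $x_k\to x$, $y_k\to y$, then $\limsup_k\phi(y_k,x_k)\le\phi(y,x)$. A *cutting plane* at serious iterate $x$ and trial step $z$ is an affine function $\phi(z,x)+g^\top(\cdot-z)$ with $g\in\partial_1\phi(z,x)$; if $z=x$ it is an *exactness plane*. A *working model* at $x$ is the maximum of finitely many affine minorants of $\phi(\cdot,x)$, at least one of which is an exactness plane. **Bundle trust-region algorithm.** Fix parameters $0<\gamma<\widetilde\gamma<1$, $\gamma<\Gamma\le1$,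 $0<\theta<1$, $M\ge1$, $q>0$, a norm $|\cdot|$ on $\mathbb R^n$ (the trust-region norm), an initial iterate $x^1$ and a memory radius $R_1^\sharp>0$. For each outer counter $j$ a symmetric positive semidefinite matrix $Q_j$ with $\|Q_j\|\le q$ is chosen. At outer counter $j$, stop if $x^j$ is critical. Otherwise put $R_1=R_j^\sharp$, choose a working model $\phi_1$ at $x^j$, and for $k=1,2,\dots$ do the following, with $\Phi_k(y)=\phi_k(y)+\frac12(y-x^j)^\top Q_j(y-x^j)$. 1. Let $y^k$ minimize $\Phi_k(y)$ subject to $|y-x^j|\le R_k$. Choose any $z^k$ with $|z^k-x^j|\le M|y^k-x^j|$ and $f(x^j)-\Phi_k(z^k)\ge\theta\,(f(x^j)-\Phi_k(y^k))$. 2. If $\rho_k=\dfrac{f(x^j)-f(z^k)}{f(x^j)-\Phi_k(z^k)}\ge\gamma$, put $x^{j+1}=z^k$ (a serious step), put $R_{j+1}^\sharp=R_k$ if $\rho_k<\Gamma$ and $R_{j+1}^\sharp=2R_k$ if $\rho_k\ge\Gamma$, and pass to outer counter $j+1$. 3. Otherwise choose a new working model $\phi_{k+1}$ at $x^j$ that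 contains a cutting plane at $z^k$ (other planes may be kept, added or dropped, as long as an exactness plane is present). Let $\widetilde\rho_k=\dfrac{f(x^j)-\phi_{k+1}(z^k)}{f(x^j)-\Phi_k(z^k)}$, put $R_{k+1}=R_k$ if $\widetilde\rho_k<\widetilde\gamma$ and $R_{k+1}=\frac12R_k$ if $\widetilde\rho_k\ge\widetilde\gamma$, and pass to inner counter $k+1$. **Theorem.** Let $f$ be locally Lipschitz with a strict first-order model $\phi$. Suppose the level set $\{x\in\mathbb R^n: f(x)\le f(x^1)\}$ is bounded, and let $(x^j)_{j\ge1}$ be an infinite sequence of serious iterates generated by the bundle trust-region algorithm. Then every accumulation point $x^*$ of $(x^j)$ is a critical point of $\min f$, that is, $0\in\partial f(x^*)$. -/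

import Mathlib

open Filter Topology

noncomputable section

namespace BundleTR

/-- The ambient space `ℝⁿ`. -/
abbrev Space (n : ℕ) : Type := EuclideanSpace ℝ (Fin n)

variable {n : ℕ}

/-! ### Subdifferentials -/

/-- Clarke directional derivative
`f°(x; d) = limsup_{u → x, t → 0⁺} (f (u + t d) - f u) / t`.
The quotients are bounded near `x` when `f` is locally Lipschitz, so that the real `limsup` is
then the usual one. -/
def clarkeDeriv (f : Space n → ℝ) (x d : Space n) : ℝ :=
  limsup (fun p : Space n × ℝ => (f (p.1 + p.2 • d) - f p.1) / p.2) (𝓝 x ×ˢ 𝓝[>] (0 : ℝ))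

/-- Clarke subdifferential `∂f(x)` of a locally Lipschitz function. -/
def clarkeSubdifferential (f : Space n → ℝ) (x : Space n) : Set (Space n) :=
  {g | ∀ d : Space n, inner ℝ g d ≤ clarkeDeriv f x d}

/-- `x` is a (Clarke) critical point of the program `min f`. -/
def IsCritical (f : Space n → ℝ) (x : Space n) : Prop :=
  (0 : Space n) ∈ clarkeSubdifferential f x

/-- Subdifferential of a convex function `h : ℝⁿ → ℝ` at `z`. -/
def convexSubdifferential (h : Space n → ℝ) (z : Space n) : Set (Space n) :=
  {g | ∀ y : Space n, h z + inner ℝ g (y - z) ≤ h y}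

/-! ### First-order models.  Throughout `φ y x` stands for `φ(y, x)`. -/

/-- `φ` is a first-order model of `f`. -/
structure IsModel (f : Space n → ℝ) (φ : Space n → Space n → ℝ) : Prop where
  convex : ∀ x, ConvexOn ℝ Set.univ (fun y => φ y x)
  exact_value : ∀ x, φ x x = f x
  subdifferential_subset : ∀ x,
    convexSubdifferential (fun y => φ y x) x ⊆ clarkeSubdifferential f x
  upper_estimate : ∀ (x : Space n) (y : ℕ → Space n), Tendsto y atTop (𝓝 x) →
    ∃ ε : ℕ → ℝ, (∀ k, 0 < ε k) ∧ Tendsto ε atTop (𝓝 0) ∧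
      ∀ k, f (y k) ≤ φ (y k) x + ε k * ‖y k - x‖
  limsup_le : ∀ (x y : Space n) (xs ys : ℕ → Space n),
    Tendsto xs atTop (𝓝 x) → Tendsto ys atTop (𝓝 y) →
      limsup (fun k => (φ (ys k) (xs k) : EReal)) atTop ≤ (φ y x : EReal)

/-- `φ` is a strict first-order model of `f`. -/
structure IsStrictModel (f : Space n → ℝ) (φ : Space n → Space n → ℝ) : Prop
    extends IsModel f φ where
  strict_upper_estimate : ∀ (x : Space n) (xs ys : ℕ → Space n),
    Tendsto xs atTop (𝓝 x) → Tendsto ys atTop (𝓝 x) →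
      ∃ ε : ℕ → ℝ, (∀ k, 0 < ε k) ∧ Tendsto ε atTop (𝓝 0) ∧
        ∀ k, f (ys k) ≤ φ (ys k) (xs k) + ε k * ‖ys k - xs k‖

/-! ### Cutting planes and working models -/

/-- `m` is a cutting plane `φ(z, x) + gᵀ(· - z)`, `g ∈ ∂₁φ(z, x)`, at serious iterate `x` and
trial step `z`. -/
def IsCuttingPlane (φ : Space n → Space n → ℝ) (x z : Space n) (m : Space n →ᵃ[ℝ] ℝ) : Prop :=
  ∃ g ∈ convexSubdifferential (fun y => φ y x) z, ∀ y, m y = φ z x + inner ℝ g (y - z)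

/-- An exactness plane at `x`: a cutting plane with trial step `z = x`. -/
def IsExactnessPlane (φ : Space n → Space n → ℝ) (x : Space n) (m : Space n →ᵃ[ℝ] ℝ) : Prop :=
  IsCuttingPlane φ x x m

/-- The polyhedral function `y ↦ max_{m ∈ P} m y`. It is only used for nonempty `P`. -/
def polyhedral (P : Finset (Space n →ᵃ[ℝ] ℝ)) (y : Space n) : ℝ :=
  ⨆ m : P, (m : Space n →ᵃ[ℝ] ℝ) y

/-- The second-order working model `max_{m ∈ P} m y + ½ (y - x)ᵀ Q (y - x)`. -/
def secondOrder (P : Finset (Space n →ᵃ[ℝ] ℝ)) (Q : Matrix (Fin n) (Fin n) ℝ)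
    (x y : Space n) : ℝ :=
  polyhedral P y + 1 / 2 * inner ℝ (y - x) (Matrix.toEuclideanCLM (𝕜 := ℝ) Q (y - x))

/-- `P` is an admissible set of planes for a first-order working model at serious iterate `x`:
finitely many affine minorants of `φ(·, x)`, at least one of which is an exactness plane. -/
structure IsWorkingModel (φ : Space n → Space n → ℝ) (x : Space n)
    (P : Finset (Space n →ᵃ[ℝ] ℝ)) : Prop where
  minorant : ∀ m ∈ P, ∀ y, m y ≤ φ y x
  exactness : ∃ m ∈ P, IsExactnessPlane φ x m

/-! ### The algorithm -/

/-- Parameters of the algorithm, including the trust-region norm, which may be any norm on `ℝⁿ`. -/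
structure Params (n : ℕ) where
  (γ γtilde Γ θ M q : ℝ)
  γ_pos : 0 < γ
  γ_lt_γtilde : γ < γtilde
  γtilde_lt_one : γtilde < 1
  γ_lt_Γ : γ < Γ
  Γ_le_one : Γ ≤ 1
  θ_pos : 0 < θ
  θ_lt_one : θ < 1
  one_le_M : 1 ≤ M
  q_pos : 0 < q
  /-- the trust-region norm -/
  trNorm : Seminorm ℝ (Space n)
  trNorm_definite : ∀ v, trNorm v = 0 → v = 0

/-- Acceptance quotient `ρ_k`, where `P` is the current working model and `z` the trial step. -/
def rho (f : Space n → ℝ) (P : Finset (Space n →ᵃ[ℝ] ℝ)) (Q : Matrix (Fin n) (Fin n) ℝ)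
    (x z : Space n) : ℝ :=
  (f x - f z) / (f x - secondOrder P Q x z)

/-- Secondary control parameter `ρ̃_k`, where `P` is the current and `P'` the updated working
model, and `z` the trial step. -/
def rhoTilde (f : Space n → ℝ) (P P' : Finset (Space n →ᵃ[ℝ] ℝ))
    (Q : Matrix (Fin n) (Fin n) ℝ) (x z : Space n) : ℝ :=
  (f x - polyhedral P' z) / (f x - secondOrder P Q x z)

/-- `y` solves the tangent program: minimize the second-order working model over the
trust-region ball with center `x` and radius `R`. -/
def IsTangentSolution (c : Params n) (P : Finset (Space n →ᵃ[ℝ] ℝ))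
    (Q : Matrix (Fin n) (Fin n) ℝ) (x : Space n) (R : ℝ) (y : Space n) : Prop :=
  c.trNorm (y - x) ≤ R ∧
    ∀ u, c.trNorm (u - x) ≤ R → secondOrder P Q x y ≤ secondOrder P Q x u

/-- `z` is an admissible trial step for the solution `y` of the tangent program. -/
def IsTrialStep (c : Params n) (f : Space n → ℝ) (P : Finset (Space n →ᵃ[ℝ] ℝ))
    (Q : Matrix (Fin n) (Fin n) ℝ) (x y z : Space n) : Prop :=
  c.trNorm (z - x) ≤ c.M * c.trNorm (y - x) ∧
    c.θ * (f x - secondOrder P Q x y) ≤ f x - secondOrder P Q x z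

/-- A completed inner loop at serious iterate `x` with matrix `Q` and initial radius `R₀`. The
inner counter starts at `0`; null steps occur at `k < last` and the serious step at `k = last`.
Values at counters beyond `last` are irrelevant. -/
structure InnerLoop (c : Params n) (f : Space n → ℝ) (φ : Space n → Space n → ℝ)
    (x : Space n) (Q : Matrix (Fin n) (Fin n) ℝ) (R₀ : ℝ) where
  /-- the counter at which the trial step is accepted -/
  last : ℕ
  /-- the planes that form the first-order working model `φ_k` -/
  planes : ℕ → Finset (Space n →ᵃ[ℝ] ℝ)
  /-- the trust-region radii -/
  R : ℕ → ℝ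
  /-- the solutions of the tangent programs -/
  y : ℕ → Space n
  /-- the trial steps -/
  z : ℕ → Space n
  R_zero : R 0 = R₀
  working : ∀ k ≤ last, IsWorkingModel φ x (planes k)
  tangent : ∀ k ≤ last, IsTangentSolution c (planes k) Q x (R k) (y k)
  trial : ∀ k ≤ last, IsTrialStep c f (planes k) Q x (y k) (z k)
  null_step : ∀ k < last, rho f (planes k) Q x (z k) < c.γ
  serious_step : c.γ ≤ rho f (planes last) Q x (z last)
  /-- a cutting plane at the unsuccessful trial step enters the next working model -/
  new_cut : ∀ k < last, ∃ m ∈ planes (k + 1), IsCuttingPlane φ x (z k) m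
  R_keep : ∀ k < last,
    rhoTilde f (planes k) (planes (k + 1)) Q x (z k) < c.γtilde → R (k + 1) = R k
  R_halve : ∀ k < last,
    c.γtilde ≤ rhoTilde f (planes k) (planes (k + 1)) Q x (z k) → R (k + 1) = 1 / 2 * R k

/-- A run of the algorithm which generates an infinite sequence `x` of serious iterates. The outer
counter starts at `0`, so that `x 0` is the initial iterate. -/
structure Run (c : Params n) (f : Space n → ℝ) (φ : Space n → Space n → ℝ) where
  /-- the serious iterates -/
  x : ℕ → Space n
  /-- the memory trust-region radii -/
  Rsharp : ℕ → ℝ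
  /-- the matrices of the second-order working models -/
  Q : ℕ → Matrix (Fin n) (Fin n) ℝ
  /-- the inner loops -/
  inner : ∀ j, InnerLoop c f φ (x j) (Q j) (Rsharp j)
  Rsharp_zero_pos : 0 < Rsharp 0
  Q_posSemidef : ∀ j, (Q j).PosSemidef
  Q_norm_le : ∀ j, ‖Matrix.toEuclideanCLM (𝕜 := ℝ) (Q j)‖ ≤ c.q
  /-- the stopping test has not been met -/
  not_critical : ∀ j, ¬ IsCritical f (x j)
  step : ∀ j, x (j + 1) = (inner j).z (inner j).last
  memory_keep : ∀ j,
    rho f ((inner j).planes (inner j).last) (Q j) (x j) ((inner j).z (inner j).last) < c.Γ →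
      Rsharp (j + 1) = (inner j).R (inner j).last
  memory_double : ∀ j,
    c.Γ ≤ rho f ((inner j).planes (inner j).last) (Q j) (x j) ((inner j).z (inner j).last) →
      Rsharp (j + 1) = 2 * (inner j).R (inner j).last

end BundleTR

end

/-!
The proof is by contradiction. Suppose that an accumulation point `x*` is not critical.

*Uniform decrease of the working models* (`exists_uniform_model_decrease`). There is `η > 0` such
that the solution `y` of every tangent program with serious iterate `x` near `x*` and radius `R`
satisfies `f x - Φ y ≥ η min(R, 1)`. Otherwise there are `x_k → x*` for which this predicted
decrease is `o(min(R_k, 1))`. As `Φ_k` is convex with `Φ_k(x_k) = f x_k`, scaling a fixed `u` into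
the trust region then gives `Φ_k u ≥ f x_k - o(1)`, so that
`φ(u, x*) + q/2 ‖u - x*‖² ≥ f x* = φ(x*, x*)` in the limit, by upper semicontinuity of the model.
A convex function which is minimal up to a quadratic term is minimal, so
`0 ∈ ∂₁φ(x*, x*) ⊆ ∂f(x*)`.

*The iterates are trapped near `x*`* (`Run.eventually_dist_lt`). The acceptance test transfers a
fixed fraction of the predicted decrease to `f`. Near `x*` the length of a serious step, which is
`O(R)`, is therefore bounded by a multiple of the decrease of `f`. The values `f (x j)` decrease to
`f x*`, so the path that follows an iterate close to `x*` is too short to leave a neighbourhood of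
`x*`. In addition the accepted radii tend to `0`.

*Small radii are not halved near `x*`* (`InnerLoop.exists_keep_radius`). A null step with halving
has `ρ̃ - ρ > γ̃ - γ`, hence `f z - φ(z, x) ≥ (γ̃ - γ) θ η R` by the uniform decrease, whereas
the strict upper estimate makes the left-hand side `o(‖z - x‖) = o(R)`.

From some outer counter on, no radius is halved any more, so that the memory radii are positive and
nondecreasing. This contradicts the convergence to `0` of the accepted radii.
-/

namespace BundleTR

variable {n : ℕ}

/-! ### Comparison of the trust-region norm with the Euclidean norm -/

namespace Params

lemma exists_trNorm_le (c : Params n) : ∃ C, 0 < C ∧ ∀ v, c.trNorm v ≤ C * ‖v‖ := by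
  have hcont : Continuous c.trNorm :=
    continuousOn_univ.1 (c.trNorm.convexOn.continuousOn isOpen_univ)
  obtain ⟨C, hC, h⟩ := Seminorm.bound_of_continuous_normedSpace c.trNorm hcont
  exact ⟨C, hC, h⟩

lemma exists_norm_le (c : Params n) : ∃ C, 0 < C ∧ ∀ v, ‖v‖ ≤ C * c.trNorm v := by
  have hcont : Continuous c.trNorm :=
    continuousOn_univ.1 (c.trNorm.convexOn.continuousOn isOpen_univ)
  -- The constant is the reciprocal of a positive lower bound on the Euclidean unit sphere.
  obtain ⟨m, hm, h⟩ : ∃ m, 0 < m ∧ ∀ v ∈ Metric.sphere (0 : Space n) 1, m ≤ c.trNorm v := by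
    rcases (Metric.sphere (0 : Space n) 1).eq_empty_or_nonempty with h0 | h0
    · exact ⟨1, one_pos, by simp [h0]⟩
    · obtain ⟨w, hw, hmin⟩ :=
        (isCompact_sphere (0 : Space n) 1).exists_isMinOn h0 hcont.continuousOn
      refine ⟨c.trNorm w, lt_of_le_of_ne (apply_nonneg _ _) fun h => ?_, fun v hv => hmin hv⟩
      rw [c.trNorm_definite w h.symm] at hw
      simp at hw
  refine ⟨m⁻¹, inv_pos.2 hm, fun v => ?_⟩
  rcases eq_or_ne v 0 with rfl | hv
  · simp
  · have hv' : 0 < ‖v‖ := norm_pos_iff.2 hv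
    have := h (‖v‖⁻¹ • v) (by simp [norm_smul, hv'.ne'])
    rw [map_smul_eq_mul, norm_inv, norm_norm] at this
    field_simp at this ⊢
    linarith

end Params

/-! ### Working models -/

lemma le_polyhedral {P : Finset (Space n →ᵃ[ℝ] ℝ)} {m : Space n →ᵃ[ℝ] ℝ} (hm : m ∈ P)
    (y : Space n) : m y ≤ polyhedral P y :=
  le_ciSup (f := fun m : P => (m : Space n →ᵃ[ℝ] ℝ) y) (Set.finite_range _).bddAbove ⟨m, hm⟩

lemma inner_toEuclideanCLM_nonneg {Q : Matrix (Fin n) (Fin n) ℝ} (hQ : Q.PosSemidef)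
    (v : Space n) : 0 ≤ inner ℝ v (Matrix.toEuclideanCLM (𝕜 := ℝ) Q v) := by
  have h := (Matrix.isPositive_toEuclideanLin_iff.2 hQ).re_inner_nonneg_right v
  exact h

lemma inner_toEuclideanCLM_le {Q : Matrix (Fin n) (Fin n) ℝ} {q : ℝ}
    (hQ : ‖Matrix.toEuclideanCLM (𝕜 := ℝ) Q‖ ≤ q) (v : Space n) :
    inner ℝ v (Matrix.toEuclideanCLM (𝕜 := ℝ) Q v) ≤ q * ‖v‖ ^ 2 := by
  have h1 := real_inner_le_norm v (Matrix.toEuclideanCLM (𝕜 := ℝ) Q v)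
  have h2 := (Matrix.toEuclideanCLM (𝕜 := ℝ) Q).le_of_opNorm_le hQ v
  have h3 := mul_le_mul_of_nonneg_left h2 (norm_nonneg v)
  linarith

namespace IsWorkingModel

variable {f : Space n → ℝ} {φ : Space n → Space n → ℝ} {x : Space n}
  {P : Finset (Space n →ᵃ[ℝ] ℝ)}

lemma polyhedral_le (hP : IsWorkingModel φ x P) (y : Space n) : polyhedral P y ≤ φ y x := by
  obtain ⟨m, hm, -⟩ := hP.exactness
  have : Nonempty P := ⟨⟨m, hm⟩⟩
  exact ciSup_le fun m => hP.minorant m m.2 y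

/-- A working model is exact at every point that contributes a cutting plane. -/
lemma polyhedral_eq (hP : IsWorkingModel φ x P) {z : Space n}
    (hz : ∃ m ∈ P, IsCuttingPlane φ x z m) : polyhedral P z = φ z x := by
  obtain ⟨m, hm, g, -, hg⟩ := hz
  refine le_antisymm (hP.polyhedral_le z) ?_
  simpa [hg] using le_polyhedral hm z

lemma secondOrder_self (hP : IsWorkingModel φ x P) (hφ : IsModel f φ)
    (Q : Matrix (Fin n) (Fin n) ℝ) : secondOrder P Q x x = f x := by
  simp [secondOrder, hP.polyhedral_eq hP.exactness, hφ.exact_value]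

lemma secondOrder_le (hP : IsWorkingModel φ x P) {Q : Matrix (Fin n) (Fin n) ℝ} {q : ℝ}
    (hQ : ‖Matrix.toEuclideanCLM (𝕜 := ℝ) Q‖ ≤ q) (u : Space n) :
    secondOrder P Q x u ≤ φ u x + q / 2 * ‖u - x‖ ^ 2 := by
  have h1 := hP.polyhedral_le u
  have h2 := inner_toEuclideanCLM_le hQ (u - x)
  unfold secondOrder
  linarith

/-- Convexity of the second-order working model along the segment from `x` to `u`. -/
lemma secondOrder_segment_le (hP : IsWorkingModel φ x P) (hφ : IsModel f φ)
    {Q : Matrix (Fin n) (Fin n) ℝ} (hQ : Q.PosSemidef) (u : Space n) {t : ℝ} (h0 : 0 ≤ t)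
    (h1 : t ≤ 1) :
    secondOrder P Q x (x + t • (u - x)) ≤ (1 - t) * f x + t * secondOrder P Q x u := by
  have hpoly : polyhedral P (x + t • (u - x)) ≤ (1 - t) * f x + t * polyhedral P u := by
    obtain ⟨m, hm, -⟩ := hP.exactness
    have : Nonempty P := ⟨⟨m, hm⟩⟩
    refine ciSup_le fun m => ?_
    have hmx : (m : Space n →ᵃ[ℝ] ℝ) x ≤ f x := hφ.exact_value x ▸ hP.minorant m m.2 x
    have hmu := le_polyhedral m.2 u
    have hm : (m : Space n →ᵃ[ℝ] ℝ) (x + t • (u - x)) =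
        (1 - t) * (m : Space n →ᵃ[ℝ] ℝ) x + t * (m : Space n →ᵃ[ℝ] ℝ) u := by
      have := (m : Space n →ᵃ[ℝ] ℝ).apply_lineMap x u t
      rw [AffineMap.lineMap_apply, AffineMap.lineMap_apply] at this
      simp only [vsub_eq_sub, vadd_eq_add, smul_eq_mul] at this
      rw [add_comm, this]
      ring
    rw [hm]
    have := mul_le_mul_of_nonneg_left hmx (sub_nonneg.2 h1)
    have := mul_le_mul_of_nonneg_left hmu h0
    linarith
  have hq := inner_toEuclideanCLM_nonneg hQ (u - x)
  have ht : t * t ≤ t := by nlinarith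
  have := mul_le_mul_of_nonneg_right ht hq
  unfold secondOrder
  rw [add_sub_cancel_left, map_smul, real_inner_smul_left, real_inner_smul_right]
  linarith

lemma model_decrease_nonneg (hP : IsWorkingModel φ x P) (hφ : IsModel f φ) {c : Params n}
    {Q : Matrix (Fin n) (Fin n) ℝ} {R : ℝ} (hR : 0 ≤ R) {y : Space n}
    (hy : IsTangentSolution c P Q x R y) : 0 ≤ f x - secondOrder P Q x y := by
  have := hy.2 x (by simpa using hR)
  rw [hP.secondOrder_self hφ] at this
  linarith

/-- If the solution of the tangent program improves on `f x` by little, then so does any other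
point `u`. The factor comes from scaling `u` into the trust region. -/
lemma sub_secondOrder_le (hP : IsWorkingModel φ x P) (hφ : IsModel f φ) {c : Params n}
    {Q : Matrix (Fin n) (Fin n) ℝ} (hQ : Q.PosSemidef) {R : ℝ} (hR : 0 < R) {y : Space n}
    (hy : IsTangentSolution c P Q x R y) {η : ℝ}
    (hη : f x - secondOrder P Q x y ≤ η * min R 1) (u : Space n) :
    f x - secondOrder P Q x u ≤ η * (1 + c.trNorm (u - x)) := by
  have hu : 0 ≤ c.trNorm (u - x) := apply_nonneg _ _
  have hmin : 0 < min R 1 := lt_min hR one_pos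
  set s := 1 + c.trNorm (u - x) with hs
  have hs1 : 1 ≤ s := by linarith
  have hs0 : 0 < s := by linarith
  set t := min R 1 / s with ht
  have ht0 : 0 < t := div_pos hmin hs0
  have hts : t * s = min R 1 := div_mul_cancel₀ _ hs0.ne'
  have ht1 : t ≤ 1 := (div_le_one hs0).2 ((min_le_right _ _).trans hs1)
  have hball : c.trNorm (x + t • (u - x) - x) ≤ R := by
    rw [add_sub_cancel_left, map_smul_eq_mul, Real.norm_of_nonneg ht0.le]
    calc t * c.trNorm (u - x) ≤ t * s := mul_le_mul_of_nonneg_left (by linarith) ht0.le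
      _ ≤ R := hts ▸ min_le_left _ _
  have h1 := hy.2 _ hball
  have h2 := hP.secondOrder_segment_le hφ hQ u ht0.le ht1
  have h3 : t * (f x - secondOrder P Q x u) ≤ t * (η * s) := by
    have : t * (η * s) = η * min R 1 := by rw [← hts]; ring
    rw [this]
    linarith
  exact le_of_mul_le_mul_left h3 ht0

end IsWorkingModel

/-! ### Consequences of the model axioms -/

/-- A convex function that is minimal at `x` up to a quadratic error is minimal at `x`. -/
lemma le_of_convexOn_of_le_add_sq {h : Space n → ℝ} (hh : ConvexOn ℝ Set.univ h) {x : Space n}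
    {C : ℝ} (hx : ∀ u, h x ≤ h u + C * ‖u - x‖ ^ 2) (u : Space n) : h x ≤ h u := by
  have key : ∀ t ∈ Set.Ioc (0 : ℝ) 1, h x ≤ h u + t * (C * ‖u - x‖ ^ 2) := by
    rintro t ⟨h0, h1⟩
    have hc := hh.2 (Set.mem_univ x) (Set.mem_univ u) (sub_nonneg.2 h1) h0.le (by ring)
    have hp : (1 - t) • x + t • u = x + t • (u - x) := by module
    rw [hp, smul_eq_mul, smul_eq_mul] at hc
    have hl := hx (x + t • (u - x))
    rw [add_sub_cancel_left, norm_smul, Real.norm_of_nonneg h0.le] at hl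
    have : t * h x ≤ t * (h u + t * (C * ‖u - x‖ ^ 2)) := by linarith
    exact le_of_mul_le_mul_left this h0
  have hlim : Tendsto (fun t : ℝ => h u + t * (C * ‖u - x‖ ^ 2)) (𝓝[>] 0) (𝓝 (h u)) := by
    have : Continuous fun t : ℝ => h u + t * (C * ‖u - x‖ ^ 2) := by fun_prop
    simpa using (this.tendsto 0).mono_left nhdsWithin_le_nhds
  exact ge_of_tendsto hlim (mem_of_superset (Ioc_mem_nhdsGT one_pos) key)

/-- The upper semicontinuity axiom for a fixed first argument. -/
lemma IsModel.le_of_tendsto {f : Space n → ℝ} {φ : Space n → Space n → ℝ} (hφ : IsModel f φ)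
    {xs : ℕ → Space n} {x : Space n} (hxs : Tendsto xs atTop (𝓝 x)) (u : Space n) {b : ℕ → ℝ}
    {β : ℝ} (hb : Tendsto b atTop (𝓝 β)) (h : ∀ k, b k ≤ φ u (xs k)) : β ≤ φ u x := by
  by_contra! hlt
  obtain ⟨m, hm, hmβ⟩ := exists_between hlt
  have hlim := hφ.limsup_le x u xs (fun _ => u) hxs tendsto_const_nhds
  have hev := eventually_lt_of_limsup_lt (hlim.trans_lt (EReal.coe_lt_coe_iff.2 hm))
  obtain ⟨k, hk1, hk2⟩ := (hev.and (hb.eventually (lt_mem_nhds hmβ))).exists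
  exact absurd (h k) (not_le.2 ((EReal.coe_lt_coe_iff.1 hk1).trans hk2))

/-- Near a point that is not critical, the tangent programs predict a decrease of at least a fixed
multiple of the trust-region radius (truncated at `1`). -/
theorem exists_uniform_model_decrease (c : Params n) {f : Space n → ℝ}
    {φ : Space n → Space n → ℝ} (hf : Continuous f) (hφ : IsModel f φ) {xstar : Space n}
    (hx : ¬ IsCritical f xstar) :
    ∃ η > 0, ∃ δ > 0, ∀ (x y : Space n) (P : Finset (Space n →ᵃ[ℝ] ℝ))
      (Q : Matrix (Fin n) (Fin n) ℝ) (R : ℝ), dist x xstar < δ → IsWorkingModel φ x P →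
      Q.PosSemidef → ‖Matrix.toEuclideanCLM (𝕜 := ℝ) Q‖ ≤ c.q → 0 < R →
      IsTangentSolution c P Q x R y → η * min R 1 ≤ f x - secondOrder P Q x y := by
  by_contra! hcon
  obtain ⟨C, hC, hCn⟩ := c.exists_trNorm_le
  have hpos : ∀ k : ℕ, (0 : ℝ) < 1 / ((k : ℝ) + 1) := fun k => by positivity
  choose xs ys P Q R hd hP hQ hQn hR hy hlt using fun k : ℕ =>
    hcon (1 / ((k : ℝ) + 1)) (hpos k) (1 / ((k : ℝ) + 1)) (hpos k)
  have hinv : Tendsto (fun k : ℕ => 1 / ((k : ℝ) + 1)) atTop (𝓝 0) :=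
    tendsto_one_div_add_atTop_nhds_zero_nat
  have hxs : Tendsto xs atTop (𝓝 xstar) :=
    tendsto_iff_dist_tendsto_zero.2
      (squeeze_zero (fun _ => dist_nonneg) (fun k => (hd k).le) hinv)
  have hquad : ∀ u, φ xstar xstar ≤ φ u xstar + c.q / 2 * ‖u - xstar‖ ^ 2 := by
    intro u
    have hb : Tendsto (fun k : ℕ => f (xs k) - c.q / 2 * ‖u - xs k‖ ^ 2
        - 1 / ((k : ℝ) + 1) * (1 + C * ‖u - xs k‖)) atTop
        (𝓝 (f xstar - c.q / 2 * ‖u - xstar‖ ^ 2 - 0 * (1 + C * ‖u - xstar‖))) := by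
      have hn : Tendsto (fun k => ‖u - xs k‖) atTop (𝓝 ‖u - xstar‖) :=
        (tendsto_const_nhds.sub hxs).norm
      exact ((hf.tendsto xstar).comp hxs |>.sub ((hn.pow 2).const_mul _)).sub
        (hinv.mul ((hn.const_mul C).const_add 1))
    have := hφ.le_of_tendsto hxs u hb fun k => by
      have h1 := (hP k).sub_secondOrder_le hφ (hQ k) (hR k) (hy k) (hlt k).le u
      have h2 := (hP k).secondOrder_le (hQn k) u
      have h3 := mul_le_mul_of_nonneg_left (hCn (u - xs k)) (hpos k).le
      linarith
    rw [hφ.exact_value]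
    linarith
  refine hx (hφ.subdifferential_subset xstar fun u => ?_)
  simpa using le_of_convexOn_of_le_add_sq (hφ.convex xstar) hquad u

/-- The strict upper estimate in the form of a local uniform bound. -/
lemma IsStrictModel.exists_le_add_mul {f : Space n → ℝ} {φ : Space n → Space n → ℝ}
    (hφ : IsStrictModel f φ) (xstar : Space n) {ε : ℝ} (hε : 0 < ε) :
    ∃ δ > 0, ∀ x z, dist x xstar < δ → dist z xstar < δ → f z ≤ φ z x + ε * ‖z - x‖ := by
  by_contra! hcon
  have hpos : ∀ k : ℕ, (0 : ℝ) < 1 / ((k : ℝ) + 1) := fun k => by positivity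
  choose xs zs hx hz hlt using fun k : ℕ => hcon (1 / ((k : ℝ) + 1)) (hpos k)
  have hinv : Tendsto (fun k : ℕ => 1 / ((k : ℝ) + 1)) atTop (𝓝 0) :=
    tendsto_one_div_add_atTop_nhds_zero_nat
  have tendsto_of {w : ℕ → Space n} (hw : ∀ k : ℕ, dist (w k) xstar < 1 / ((k : ℝ) + 1)) :
      Tendsto w atTop (𝓝 xstar) :=
    tendsto_iff_dist_tendsto_zero.2
      (squeeze_zero (fun _ => dist_nonneg) (fun k => (hw k).le) hinv)
  obtain ⟨e, -, he, hle⟩ := hφ.strict_upper_estimate xstar xs zs (tendsto_of hx) (tendsto_of hz)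
  obtain ⟨k, hk⟩ := (he.eventually (gt_mem_nhds hε)).exists
  have := mul_le_mul_of_nonneg_right hk.le (norm_nonneg (zs k - xs k))
  linarith [hle k, hlt k]

/-! ### The inner loop -/

namespace InnerLoop

variable {c : Params n} {f : Space n → ℝ} {φ : Space n → Space n → ℝ} {x : Space n}
  {Q : Matrix (Fin n) (Fin n) ℝ} {R₀ : ℝ}

lemma R_succ (L : InnerLoop c f φ x Q R₀) {k : ℕ} (hk : k < L.last) :
    L.R (k + 1) = L.R k ∨ L.R (k + 1) = 1 / 2 * L.R k :=
  (lt_or_ge _ _).imp (L.R_keep k hk) (L.R_halve k hk)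

lemma R_pos (L : InnerLoop c f φ x Q R₀) (h0 : 0 < R₀) {k : ℕ} (hk : k ≤ L.last) :
    0 < L.R k := by
  induction k with
  | zero => rwa [L.R_zero]
  | succ k ih =>
    have := ih (by omega)
    rcases L.R_succ (show k < L.last by omega) with h | h <;> rw [h]
    · exact this
    · linarith

lemma model_decrease_le (L : InnerLoop c f φ x Q R₀) {k : ℕ} (hk : k ≤ L.last) :
    c.θ * (f x - secondOrder (L.planes k) Q x (L.y k)) ≤
      f x - secondOrder (L.planes k) Q x (L.z k) :=
  (L.trial k hk).2

lemma trial_decrease_nonneg (L : InnerLoop c f φ x Q R₀) (hφ : IsModel f φ) (h0 : 0 < R₀)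
    {k : ℕ} (hk : k ≤ L.last) : 0 ≤ f x - secondOrder (L.planes k) Q x (L.z k) :=
  (mul_nonneg c.θ_pos.le ((L.working k hk).model_decrease_nonneg hφ (L.R_pos h0 hk).le
    (L.tangent k hk))).trans (L.model_decrease_le hk)

/-- A serious step realizes the fraction `γ` of the predicted decrease. -/
lemma serious_decrease (L : InnerLoop c f φ x Q R₀) (hφ : IsModel f φ) (h0 : 0 < R₀) :
    c.γ * (f x - secondOrder (L.planes L.last) Q x (L.z L.last)) ≤ f x - f (L.z L.last) := by
  have hD := L.trial_decrease_nonneg hφ h0 le_rfl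
  have hs := L.serious_step
  unfold rho at hs
  -- Division by zero would give the quotient `0 < γ`, and the step would not be accepted.
  rcases hD.eq_or_lt with h | h
  · rw [← h, div_zero] at hs
    exact absurd hs (not_le.2 c.γ_pos)
  · exact (le_div_iff₀ h).1 hs

lemma norm_trial_sub_le (L : InnerLoop c f φ x Q R₀) {C : ℝ} (hC : 0 < C)
    (hCn : ∀ v, ‖v‖ ≤ C * c.trNorm v) {k : ℕ} (hk : k ≤ L.last) :
    ‖L.z k - x‖ ≤ C * c.M * L.R k := by
  have hM : 0 ≤ c.M := zero_le_one.trans c.one_le_M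
  calc ‖L.z k - x‖ ≤ C * c.trNorm (L.z k - x) := hCn _
    _ ≤ C * (c.M * L.R k) :=
      mul_le_mul_of_nonneg_left ((L.trial k hk).1.trans
        (mul_le_mul_of_nonneg_left (L.tangent k hk).1 hM)) hC.le
    _ = C * c.M * L.R k := by ring

/-- At a null step with halving of the radius, the cutting plane misses the value of `f` by a fixed
fraction of the predicted decrease. -/
lemma halving_gap (L : InnerLoop c f φ x Q R₀) (hφ : IsModel f φ) (h0 : 0 < R₀) {k : ℕ}
    (hk : k < L.last)
    (hr : c.γtilde ≤ rhoTilde f (L.planes k) (L.planes (k + 1)) Q x (L.z k)) :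
    0 < f x - secondOrder (L.planes k) Q x (L.z k) ∧
      (c.γtilde - c.γ) * (f x - secondOrder (L.planes k) Q x (L.z k)) <
        f (L.z k) - φ (L.z k) x := by
  have hD := L.trial_decrease_nonneg hφ h0 hk.le
  have hn := L.null_step k hk
  have hcut := (L.working (k + 1) hk).polyhedral_eq (L.new_cut k hk)
  unfold rhoTilde at hr
  unfold rho at hn
  rw [hcut] at hr
  have hpos : 0 < f x - secondOrder (L.planes k) Q x (L.z k) := by
    refine hD.lt_of_ne' fun h => ?_
    rw [h, div_zero] at hr
    linarith [c.γ_pos, c.γ_lt_γtilde]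
  rw [le_div_iff₀ hpos] at hr
  rw [div_lt_iff₀ hpos] at hn
  exact ⟨hpos, by linarith⟩

/-- Near a point that is not critical, an inner loop which ends with a small radius has not changed
its radius. -/
theorem exists_keep_radius (c : Params n) {f : Space n → ℝ} {φ : Space n → Space n → ℝ}
    (hf : Continuous f) (hφ : IsStrictModel f φ) {xstar : Space n}
    (hx : ¬ IsCritical f xstar) :
    ∃ δ > 0, ∃ r > 0, ∀ (x : Space n) (Q : Matrix (Fin n) (Fin n) ℝ) (R₀ : ℝ)
      (L : InnerLoop c f φ x Q R₀), dist x xstar < δ → Q.PosSemidef →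
      ‖Matrix.toEuclideanCLM (𝕜 := ℝ) Q‖ ≤ c.q → 0 < R₀ → L.R L.last < r →
      L.R L.last = R₀ := by
  obtain ⟨η, hη, δ₁, hδ₁, hdec⟩ := exists_uniform_model_decrease c hf hφ.toIsModel hx
  obtain ⟨C, hC, hCn⟩ := c.exists_norm_le
  have hM : 0 < c.M := one_pos.trans_le c.one_le_M
  have hCM : 0 < C * c.M := mul_pos hC hM
  have hγ : 0 < c.γtilde - c.γ := sub_pos.2 c.γ_lt_γtilde
  have hθ := c.θ_pos
  -- With this `ε` the strict estimate contradicts `halving_gap`.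
  obtain ⟨δ₂, hδ₂, hup⟩ := hφ.exists_le_add_mul xstar
    (ε := (c.γtilde - c.γ) * (c.θ * η) / (C * c.M)) (by positivity)
  refine ⟨min δ₁ (δ₂ / 2), lt_min hδ₁ (half_pos hδ₂),
    min (1 / 2) (δ₂ / (4 * (C * c.M))), by positivity, ?_⟩
  intro x Q R₀ L hxd hQ hQn h0 hr
  have hxδ₁ := hxd.trans_le (min_le_left _ _)
  have hxδ₂ := hxd.trans_le (min_le_right _ _)
  have hr1 := hr.trans_le (min_le_left _ _)
  have hr2 := hr.trans_le (min_le_right _ _)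
  -- Downward induction: a halving at `k` would start from the radius `2 * L.R L.last`.
  suffices h : ∀ k ≤ L.last, L.R k = L.R L.last from
    (h 0 (Nat.zero_le _)).symm.trans L.R_zero
  intro k hk
  induction hk using Nat.decreasingInduction with
  | self => rfl
  | of_succ k hk ih =>
    rcases lt_or_ge (rhoTilde f (L.planes k) (L.planes (k + 1)) Q x (L.z k)) c.γtilde with h | h
    · rw [← ih, L.R_keep k hk h]
    · exfalso
      have hRk : L.R k = 2 * L.R L.last := by
        have := L.R_halve k hk h
        linarith
      have hRpos := L.R_pos h0 hk.le
      have hz := L.norm_trial_sub_le hC hCn hk.le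
      have hzlt : C * c.M * L.R k < δ₂ / 2 := by
        rw [lt_div_iff₀ (by positivity)] at hr2
        rw [hRk]
        linarith
      have hzd : dist (L.z k) xstar < δ₂ := by
        have := dist_triangle (L.z k) x xstar
        rw [dist_eq_norm (L.z k) x] at this
        linarith
      have hmodel := hup x (L.z k) (by linarith) hzd
      have hgap := (L.halving_gap hφ.toIsModel h0 hk h).2
      have hdk := hdec x (L.y k) _ Q _ hxδ₁ (L.working k hk.le) hQ hQn hRpos (L.tangent k hk.le)
      rw [min_eq_left (by linarith)] at hdk
      have h1 := mul_le_mul_of_nonneg_left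
        ((mul_le_mul_of_nonneg_left hdk hθ.le).trans (L.model_decrease_le hk.le)) hγ.le
      have h2 : (c.γtilde - c.γ) * (c.θ * η) / (C * c.M) * ‖L.z k - x‖ ≤
          (c.γtilde - c.γ) * (c.θ * (η * L.R k)) := by
        refine (mul_le_mul_of_nonneg_left hz (by positivity)).trans_eq ?_
        field_simp
      linarith

end InnerLoop

/-! ### Infinite runs -/

namespace Run

variable {c : Params n} {f : Space n → ℝ} {φ : Space n → Space n → ℝ}

/-- The radius at which the serious step of outer counter `j` is accepted. -/
def acceptedRadius (run : Run c f φ) (j : ℕ) : ℝ :=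
  (run.inner j).R (run.inner j).last

lemma Rsharp_succ (run : Run c f φ) (j : ℕ) :
    run.Rsharp (j + 1) = run.acceptedRadius j ∨
      run.Rsharp (j + 1) = 2 * run.acceptedRadius j :=
  (lt_or_ge _ _).imp (run.memory_keep j) (run.memory_double j)

lemma Rsharp_pos (run : Run c f φ) (j : ℕ) : 0 < run.Rsharp j := by
  induction j with
  | zero => exact run.Rsharp_zero_pos
  | succ j ih =>
    have : 0 < run.acceptedRadius j := (run.inner j).R_pos ih le_rfl
    rcases run.Rsharp_succ j with h | h <;> rw [h] <;> linarith

lemma acceptedRadius_pos (run : Run c f φ) (j : ℕ) : 0 < run.acceptedRadius j :=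
  (run.inner j).R_pos (run.Rsharp_pos j) le_rfl

lemma acceptedRadius_le_Rsharp_succ (run : Run c f φ) (j : ℕ) :
    run.acceptedRadius j ≤ run.Rsharp (j + 1) := by
  have := run.acceptedRadius_pos j
  rcases run.Rsharp_succ j with h | h <;> linarith

lemma antitone_values (run : Run c f φ) (hφ : IsModel f φ) :
    Antitone fun j => f (run.x j) := by
  refine antitone_nat_of_succ_le fun j => ?_
  have h1 := (run.inner j).serious_decrease hφ (run.Rsharp_pos j)
  have h2 := mul_nonneg c.γ_pos.le
    ((run.inner j).trial_decrease_nonneg hφ (run.Rsharp_pos j) le_rfl)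
  rw [run.step j]
  linarith

lemma tendsto_values (run : Run c f φ) (hf : Continuous f) (hφ : IsModel f φ)
    {xstar : Space n} (hacc : MapClusterPt xstar atTop run.x) :
    Tendsto (fun j => f (run.x j)) atTop (𝓝 (f xstar)) := by
  obtain ⟨ψ, hψ, hlim⟩ := hacc.tendsto_subseq
  exact (tendsto_iff_tendsto_subseq_of_antitone (run.antitone_values hφ) hψ.tendsto_atTop).2
    ((hf.tendsto xstar).comp hlim)

/-- Near an accumulation point that is not critical, the accepted radii and the lengths of the
serious steps are eventually bounded by multiples of the decrease of `f`. -/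
lemma exists_radius_le_decrease (run : Run c f φ) (hf : Continuous f) (hφ : IsModel f φ)
    {xstar : Space n} (hacc : MapClusterPt xstar atTop run.x) (hx : ¬ IsCritical f xstar) :
    ∃ K > 0, ∃ δ > 0, ∀ᶠ j in atTop, dist (run.x j) xstar < δ →
      run.acceptedRadius j ≤ K * (f (run.x j) - f (run.x (j + 1))) ∧
      dist (run.x (j + 1)) (run.x j) ≤ K * (f (run.x j) - f (run.x (j + 1))) := by
  obtain ⟨η, hη, δ, hδ, hdec⟩ := exists_uniform_model_decrease c hf hφ hx
  obtain ⟨C, hC, hCn⟩ := c.exists_norm_le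
  have hCM : 0 < C * c.M := mul_pos hC (one_pos.trans_le c.one_le_M)
  have hγ := c.γ_pos
  have hθ := c.θ_pos
  set κ := c.γ * (c.θ * η) with hκ
  have hκ0 : 0 < κ := by positivity
  refine ⟨(1 + C * c.M) / κ, by positivity, δ, hδ, ?_⟩
  have hlim := run.tendsto_values hf hφ hacc
  have hdiff : Tendsto (fun j => f (run.x j) - f (run.x (j + 1))) atTop (𝓝 0) := by
    simpa using hlim.sub (hlim.comp (tendsto_add_atTop_nat 1))
  filter_upwards [hdiff.eventually (gt_mem_nhds hκ0)] with j hj hjd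
  have hRpos := run.acceptedRadius_pos j
  have hbound : κ * min (run.acceptedRadius j) 1 ≤ f (run.x j) - f (run.x (j + 1)) := by
    have h1 := hdec _ _ _ _ _ hjd ((run.inner j).working _ le_rfl) (run.Q_posSemidef j)
      (run.Q_norm_le j) hRpos ((run.inner j).tangent _ le_rfl)
    have h2 := (mul_le_mul_of_nonneg_left h1 hθ.le).trans
      ((run.inner j).model_decrease_le le_rfl)
    have h3 := (mul_le_mul_of_nonneg_left h2 hγ.le).trans
      ((run.inner j).serious_decrease hφ (run.Rsharp_pos j))
    rw [run.step j]
    refine le_trans (le_of_eq ?_) h3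
    rw [hκ]
    ring
  -- The decrease is eventually less than `κ`, which excludes radii beyond the truncation at `1`.
  have hR1 : run.acceptedRadius j ≤ 1 := by
    by_contra! h
    rw [min_eq_right h.le] at hbound
    linarith
  rw [min_eq_left hR1] at hbound
  have hstep : dist (run.x (j + 1)) (run.x j) ≤ C * c.M * run.acceptedRadius j := by
    rw [run.step j, dist_eq_norm]
    exact (run.inner j).norm_trial_sub_le hC hCn le_rfl
  have hK : (1 + C * c.M) * run.acceptedRadius j ≤
      (1 + C * c.M) / κ * (f (run.x j) - f (run.x (j + 1))) := by
    rw [div_mul_eq_mul_div, le_div_iff₀ hκ0]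
    have := mul_le_mul_of_nonneg_left hbound (by positivity : 0 ≤ 1 + C * c.M)
    linarith
  have := mul_pos hCM hRpos
  constructor <;> linarith

/-- If an accumulation point is not critical, then the iterates converge to it. -/
theorem eventually_dist_lt (run : Run c f φ) (hf : Continuous f) (hφ : IsModel f φ)
    {xstar : Space n} (hacc : MapClusterPt xstar atTop run.x) (hx : ¬ IsCritical f xstar)
    {ε : ℝ} (hε : 0 < ε) : ∀ᶠ j in atTop, dist (run.x j) xstar < ε := by
  obtain ⟨K, hK, δ, hδ, hstep⟩ := run.exists_radius_le_decrease hf hφ hacc hx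
  obtain ⟨J, hJ⟩ := eventually_atTop.1 hstep
  set r := min δ ε with hr
  have hr0 : 0 < r := lt_min hδ hε
  have hlim := run.tendsto_values hf hφ hacc
  have hge : ∀ j, f xstar ≤ f (run.x j) := (run.antitone_values hφ).le_of_tendsto hlim
  have hsmall : ∀ᶠ j in atTop, f (run.x j) < f xstar + r / (2 * K) :=
    hlim.eventually (gt_mem_nhds (by linarith [show 0 < r / (2 * K) by positivity]))
  obtain ⟨i, hid, hiJ, hif⟩ :=
    ((mapClusterPt_iff_frequently.1 hacc _ (Metric.ball_mem_nhds xstar (half_pos hr0))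
      ).and_eventually ((eventually_ge_atTop J).and hsmall)).exists
  have hid' : dist (run.x i) xstar < r / 2 := hid
  -- The path from `x i` has length at most `K (f (x i) - f x*) < r / 2`.
  have hin : ∀ j, i ≤ j → dist (run.x j) (run.x i) ≤ K * (f (run.x i) - f (run.x j)) →
      dist (run.x j) xstar < r := by
    intro j _ hj
    have h1 : K * (f (run.x i) - f (run.x j)) < r / 2 := by
      have h2 : f (run.x i) - f (run.x j) < r / (2 * K) := by linarith [hge j]
      rw [lt_div_iff₀ (by positivity)] at h2
      linarith
    linarith [dist_triangle (run.x j) (run.x i) xstar]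
  have hpath : ∀ j, i ≤ j → dist (run.x j) (run.x i) ≤ K * (f (run.x i) - f (run.x j)) := by
    intro j hij
    induction j, hij using Nat.le_induction with
    | base => simp
    | succ j hij ih =>
      have := (hJ j (hiJ.trans hij) ((hin j hij ih).trans_le (min_le_left _ _))).2
      linarith [dist_triangle (run.x (j + 1)) (run.x j) (run.x i)]
  filter_upwards [eventually_ge_atTop i] with j hj
  exact (hin j hj (hpath j hj)).trans_le (min_le_right _ _)

lemma tendsto_acceptedRadius (run : Run c f φ) (hf : Continuous f) (hφ : IsModel f φ)
    {xstar : Space n} (hacc : MapClusterPt xstar atTop run.x) (hx : ¬ IsCritical f xstar) :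
    Tendsto run.acceptedRadius atTop (𝓝 0) := by
  obtain ⟨K, hK, δ, hδ, hstep⟩ := run.exists_radius_le_decrease hf hφ hacc hx
  have hlim := run.tendsto_values hf hφ hacc
  have hdiff : Tendsto (fun j => K * (f (run.x j) - f (run.x (j + 1)))) atTop (𝓝 0) := by
    simpa using (hlim.sub (hlim.comp (tendsto_add_atTop_nat 1))).const_mul K
  refine tendsto_of_tendsto_of_tendsto_of_le_of_le' tendsto_const_nhds hdiff
    (Eventually.of_forall fun j => (run.acceptedRadius_pos j).le) ?_
  filter_upwards [hstep, run.eventually_dist_lt hf hφ hacc hx hδ] with j h1 h2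
  exact (h1 h2).1

end Run

end BundleTR

theorem mainTheorem3 {n : ℕ} (c : BundleTR.Params n)
    (f : BundleTR.Space n → ℝ) (φ : BundleTR.Space n → BundleTR.Space n → ℝ)
    (hf : LocallyLipschitz f) (hφ : BundleTR.IsStrictModel f φ)
    (run : BundleTR.Run c f φ)
    (hbdd : Bornology.IsBounded {u : BundleTR.Space n | f u ≤ f (run.x 0)})
    (xstar : BundleTR.Space n) (hacc : MapClusterPt xstar atTop run.x) :
    BundleTR.IsCritical f xstar := by
  by_contra hx
  have hfc := hf.continuous
  obtain ⟨δ, hδ, r, hr, hkeep⟩ := BundleTR.InnerLoop.exists_keep_radius c hfc hφ hx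
  have hR := run.tendsto_acceptedRadius hfc hφ.toIsModel hacc hx
  obtain ⟨J, hJ⟩ := eventually_atTop.1
    ((run.eventually_dist_lt hfc hφ.toIsModel hacc hx hδ).and (hR.eventually (gt_mem_nhds hr)))
  have heq : ∀ j, J ≤ j → run.acceptedRadius j = run.Rsharp j := fun j hj =>
    hkeep _ _ _ (run.inner j) (hJ j hj).1 (run.Q_posSemidef j) (run.Q_norm_le j)
      (run.Rsharp_pos j) (hJ j hj).2
  have hmono : ∀ j, J ≤ j → run.Rsharp J ≤ run.Rsharp j := by
    intro j hj
    induction j, hj using Nat.le_induction with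
    | base => exact le_rfl
    | succ j hj ih =>
      exact ih.trans ((heq j hj).symm.trans_le (run.acceptedRadius_le_Rsharp_succ j))
  have hle : run.Rsharp J ≤ 0 := ge_of_tendsto hR <| by
    filter_upwards [eventually_ge_atTop J] with j hj
    exact (hmono j hj).trans_eq (heq j hj).symm
  exact absurd (run.Rsharp_pos J) (not_lt.2 hle)
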